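/- Vocabularies are finite and purely relational, and structures are allowed to be empty. Formulas are in negation normal form and have finitely many free variables. Fix a vocabulary $\tau$. **Logics.** Let $\kappa\ge\omega$ be a cardinal. For ordinals $\lambda$ the classes $\tilde\Sigma_{\kappa,\lambda}$ and $\tilde\Pi_{\kappa,\lambda}$ are defined by simultaneous recursion. For $\lambda=0$ both are the class of quantifier-free first-order formulas, including $\mathsf{True}$ and $\mathsf{False}$. For $\lambda>0$, a $\tilde\Sigma_{\kappa,\lambda}$ formula is of the form $\exists y_1\cdots\exists y_r\bigwedge_{i\in I}\gamma_i$ with $r\in\mathbb N$, $|I|<\kappa$ and each $\gamma_i$ in $\tilde\Pi_{\kappa,\lambda_i}$ for some $\lambda_i<\lambda$; a $\tilde\Pi_{\kappa,\lambda}$ formula is of the form $\forall y_1\cdots\forall y_r\bigvee_{i\in I}\gamma_i$ with $r\in\mathbb N$, $|I|<\kappa$ and each $\gamma_i$ in $\tilde\Sigma_{\kappa,\lambda_i}$ for some $\lambda_i<\lambda$. The rank of a formula is the supremum of the numbers of quantifiers on the root-to-leaf paths of its parse tree. For a cardinal $\mu\ge 0$, $\mathcal L[\mu]$ is the class of $\mathcal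 L$ formulas of rank at most $\mu$. Finally $\tilde\Sigma_{\infty,\lambda}[\mu]=\bigcup_{\kappa\ge\omega}\tilde\Sigma_{\kappa,\lambda}[\mu]$ and $\tilde\Pi_{\infty,\lambda}[\mu]=\bigcup_{\kappa\ge\omega}\tilde\Pi_{\kappa,\lambda}[\mu]$. **Sum-like operations.** For $\tau$-structures $A_1,A_2$, the annotated disjoint union is their disjoint union expanded by a new unary predicate $P$ that holds exactly on the elements of $A_1$. A binary operation $\divideontimes$ on $\tau$-structures is *quantifier-free sum-like* if there are quantifier-free formulas $\xi_U(x)$ and $\xi_R(\bar y_R)$ ($R\in\tau$, $|\bar y_R|=\mathrm{ar}(R)$) over $\tau\cup\{P\}$ such that, for all $A_1,A_2$, the structure $A_1\divideontimes A_2$ is, up to isomorphism, the $\tau$-structure whose universe is the set defined by $\xi_U$ in the annotated disjoint union of $A_1$ and $A_2$, and in which each $R$ is interpreted as the relation defined by $\xi_R$, restricted to this universe. **Decompositions.** Let $\mathcal L$ be a logic. An $\mathcal L$ reduction sequence (of sentences) is a triple $D=(\Delta_1,\Delta_2,\beta)$, where $\Delta_j=(\psi_{i,j})_{i\in I}$ is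 a family of $\mathcal L$ sentences over $\tau$ for $j=1,2$, and $\beta$ is built from propositional variables $X_{i,j}$ ($i\in I$, $j\in\{1,2\}$) by conjunctions and disjunctions of arbitrary arity. We write $(A_1,A_2)\models D$ if $\beta$ is true under the assignment that makes $X_{i,j}$ true exactly when $A_j\models\psi_{i,j}$. $D$ is a *Feferman–Vaught decomposition* of a sentence $\varphi$ over $\divideontimes$ if, for all $\tau$-structures $A_1,A_2$, we have $A_1\divideontimes A_2\models\varphi$ if and only if $(A_1,A_2)\models D$. **The function $\rho$.** Let $\mathsf{tower}(0,\kappa)=\kappa$, $\mathsf{tower}(\lambda+1,\kappa)=2^{\mathsf{tower}(\lambda,\kappa)}$, and $\mathsf{tower}(\lambda,\kappa)=2^{\sup_{\lambda'<\lambda}\mathsf{tower}(\lambda',\kappa)}$ for limit ordinals $\lambda$. Let $\rho(\kappa,\lambda)=\mathsf{tower}(\lambda,\kappa)$ if $\kappa>\omega$, and $\rho(\omega,\lambda)=\omega$. **Theorem.** Let $\kappa\ge\omega$ and $\mu\ge 0$ be cardinals, let $\lambda\ge 0$ be an ordinal, and let $\divideontimes$ be a quantifier-free sum-like binary operation on $\tau$-structures.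 1. Every $\tilde\Sigma_{\kappa,\lambda}[\mu]$ sentence over $\tau$ has a Feferman–Vaught decomposition over $\divideontimes$ that is a $\tilde\Sigma_{\rho(\kappa,\lambda),\lambda}[\mu]$ reduction sequence, and every $\tilde\Pi_{\kappa,\lambda}[\mu]$ sentence over $\tau$ has one that is a $\tilde\Pi_{\rho(\kappa,\lambda),\lambda}[\mu]$ reduction sequence. 2. Every $\tilde\Sigma_{\infty,\lambda}[\mu]$ sentence over $\tau$ has a Feferman–Vaught decomposition over $\divideontimes$ that is a $\tilde\Sigma_{\infty,\lambda}[\mu]$ reduction sequence, and every $\tilde\Pi_{\infty,\lambda}[\mu]$ sentence over $\tau$ has one that is a $\tilde\Pi_{\infty,\lambda}[\mu]$ reduction sequence. -/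

import Mathlib

open scoped FirstOrder Cardinal

universe p q w u

namespace FVaught

/-! ### Infinitary formulas in negation normal form -/

/-- Infinitary formulas in negation normal form over the relation symbols of `L`, with free variables
indexed by `Fin n` (so every formula has only finitely many free variables). The quantifiers in
`ex φ` and `all φ` bind the last variable of `φ`. -/
inductive Formula (L : FirstOrder.Language.{p, q}) : ℕ → Type (max q (w + 1))
  | rel {n k : ℕ} (R : L.Relations k) (x : Fin k → Fin n) : Formula L n
  | nrel {n k : ℕ} (R : L.Relations k) (x : Fin k → Fin n) : Formula L n
  | eq {n : ℕ} (x y : Fin n) : Formula L n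
  | neq {n : ℕ} (x y : Fin n) : Formula L n
  | conj {n : ℕ} (I : Type w) (φ : I → Formula L n) : Formula L n
  | disj {n : ℕ} (I : Type w) (φ : I → Formula L n) : Formula L n
  | ex {n : ℕ} (φ : Formula L (n + 1)) : Formula L n
  | all {n : ℕ} (φ : Formula L (n + 1)) : Formula L n

namespace Formula

variable {L : FirstOrder.Language.{p, q}}

/-- Satisfaction of a formula in an `L`-structure `M` (possibly empty). -/
def Realize {M : Type u} [L.Structure M] : {n : ℕ} → Formula.{p, q, w} L n → (Fin n → M) → Prop
  | _, rel R x, v => FirstOrder.Language.Structure.RelMap R (fun i => v (x i))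
  | _, nrel R x, v => ¬ FirstOrder.Language.Structure.RelMap R (fun i => v (x i))
  | _, eq x y, v => v x = v y
  | _, neq x y, v => v x ≠ v y
  | _, conj _ φ, v => ∀ i, Realize (φ i) v
  | _, disj _ φ, v => ∃ i, Realize (φ i) v
  | _, ex φ, v => ∃ a : M, Realize φ (Fin.snoc (α := fun _ => M) v a)
  | _, all φ, v => ∀ a : M, Realize φ (Fin.snoc (α := fun _ => M) v a)

/-- The quantifier rank: the supremum over all root-to-leaf paths of the parse tree of the number of
quantifiers on the path. -/
noncomputable def rank : {n : ℕ} → Formula.{p, q, w} L n → Cardinal.{w}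
  | _, rel _ _ => 0
  | _, nrel _ _ => 0
  | _, eq _ _ => 0
  | _, neq _ _ => 0
  | _, conj _ φ => ⨆ i, rank (φ i)
  | _, disj _ φ => ⨆ i, rank (φ i)
  | _, ex φ => rank φ + 1
  | _, all φ => rank φ + 1

/-- Quantifier-free first-order formulas in negation normal form: finite conjunctions and
disjunctions, starting from literals. The conjunction and the disjunction of arity `0` are the
formulas `True` and `False`. -/
inductive IsQF : {n : ℕ} → Formula.{p, q, w} L n → Prop
  | rel {n k : ℕ} (R : L.Relations k) (x : Fin k → Fin n) : IsQF (rel R x)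
  | nrel {n k : ℕ} (R : L.Relations k) (x : Fin k → Fin n) : IsQF (nrel R x)
  | eq {n : ℕ} (x y : Fin n) : IsQF (eq x y)
  | neq {n : ℕ} (x y : Fin n) : IsQF (neq x y)
  | conj {n : ℕ} (I : Type w) (hI : Finite I) (φ : I → Formula L n) (h : ∀ i, IsQF (φ i)) :
      IsQF (conj I φ)
  | disj {n : ℕ} (I : Type w) (hI : Finite I) (φ : I → Formula L n) (h : ∀ i, IsQF (φ i)) :
      IsQF (disj I φ)

end Formula

/-! ### The logics -/

/-- The two kinds of classes, `Σ̃` and `Π̃`. -/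
inductive Kind
  | sigma
  | pi

/-- `InClass κ Kind.sigma lam φ` says that `φ` is a `Σ̃_{κ,lam}` formula, and `InClass κ Kind.pi lam φ`
that it is a `Π̃_{κ,lam}` formula. For `lam = 0` both are the quantifier-free formulas. For `lam > 0`,
a `Σ̃_{κ,lam}` formula is a finite (possibly empty) block of existential quantifiers followed by a
conjunction of arity `< κ` of formulas each of which is in `Π̃_{κ,l}` for some `l < lam`; dually for
`Π̃_{κ,lam}`. -/
inductive InClass {L : FirstOrder.Language.{p, q}} (κ : Cardinal.{w}) :
    Kind → Ordinal.{w} → {n : ℕ} → Formula.{p, q, w} L n → Prop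
  | qf (K : Kind) {n : ℕ} (φ : Formula L n) (h : φ.IsQF) : InClass κ K 0 φ
  | sigma_conj {lam : Ordinal.{w}} (hlam : 0 < lam) {n : ℕ} (I : Type w) (hI : #I < κ)
      (l : I → Ordinal.{w}) (hl : ∀ i, l i < lam) (γ : I → Formula L n)
      (h : ∀ i, InClass κ Kind.pi (l i) (γ i)) : InClass κ Kind.sigma lam (Formula.conj I γ)
  | sigma_ex {lam : Ordinal.{w}} (hlam : 0 < lam) {n : ℕ} (φ : Formula L (n + 1))
      (h : InClass κ Kind.sigma lam φ) : InClass κ Kind.sigma lam (Formula.ex φ)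
  | pi_disj {lam : Ordinal.{w}} (hlam : 0 < lam) {n : ℕ} (I : Type w) (hI : #I < κ)
      (l : I → Ordinal.{w}) (hl : ∀ i, l i < lam) (γ : I → Formula L n)
      (h : ∀ i, InClass κ Kind.sigma (l i) (γ i)) : InClass κ Kind.pi lam (Formula.disj I γ)
  | pi_all {lam : Ordinal.{w}} (hlam : 0 < lam) {n : ℕ} (φ : Formula L (n + 1))
      (h : InClass κ Kind.pi lam φ) : InClass κ Kind.pi lam (Formula.all φ)

/-- The sentences of the logic `Σ̃_{κ,lam}[μ]`, respectively `Π̃_{κ,lam}[μ]`. -/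
def sentences (L : FirstOrder.Language.{p, q}) (K : Kind) (κ : Cardinal.{w}) (lam : Ordinal.{w})
    (μ : Cardinal.{w}) : Set (Formula.{p, q, w} L 0) :=
  {φ | InClass κ K lam φ ∧ φ.rank ≤ μ}

/-- The sentences of the logic `Σ̃_{∞,lam}[μ]`, respectively `Π̃_{∞,lam}[μ]`: the union over all
infinite cardinals `κ`. -/
def sentencesInf (L : FirstOrder.Language.{p, q}) (K : Kind) (lam : Ordinal.{w}) (μ : Cardinal.{w}) :
    Set (Formula.{p, q, w} L 0) :=
  {φ | ∃ κ : Cardinal.{w}, ℵ₀ ≤ κ ∧ φ ∈ sentences L K κ lam μ}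

/-- The `lam`-fold exponential of `κ`. Every value at an ordinal `> 0` is `2` to the power of the
preceding value; for a limit ordinal the role of the preceding value is played by the supremum of all
earlier values. -/
noncomputable def tower (lam : Ordinal.{w}) (κ : Cardinal.{w}) : Cardinal.{w} :=
  Ordinal.limitRecOn (motive := fun _ => Cardinal.{w}) lam κ
    (fun _ t => (2 : Cardinal.{w}) ^ t)
    (fun l _ t => (2 : Cardinal.{w}) ^ (⨆ a : Set.Iio l, t a.1 a.2))

/-- `ρ(κ, lam)`. -/
noncomputable def rho (κ : Cardinal.{w}) (lam : Ordinal.{w}) : Cardinal.{w} :=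
  open Classical in if ℵ₀ < κ then tower lam κ else ℵ₀

/-! ### Sum-like operations -/

/-- The relation symbols of the vocabulary consisting of one unary predicate `P`. -/
inductive AnnotRel : ℕ → Type
  | P : AnnotRel 1

/-- The vocabulary consisting of one unary predicate `P`. -/
def annot : FirstOrder.Language.{0, 0} := ⟨fun _ => Empty, AnnotRel⟩

/-- The vocabulary `L` together with a new unary predicate `P`. -/
abbrev annotate (L : FirstOrder.Language.{p, q}) : FirstOrder.Language.{p, q} := L.sum annot

/-- The relations of the annotated disjoint union. -/
def annotatedRel {L : FirstOrder.Language.{p, q}} (A B : Type u) [L.Structure A] [L.Structure B] {k : ℕ} :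
    (annotate L).Relations k → (Fin k → A ⊕ B) → Prop
  | Sum.inl R, x =>
      (∃ a : Fin k → A, x = (fun i => Sum.inl (a i)) ∧ FirstOrder.Language.Structure.RelMap R a) ∨
      (∃ b : Fin k → B, x = (fun i => Sum.inr (b i)) ∧ FirstOrder.Language.Structure.RelMap R b)
  | Sum.inr AnnotRel.P, x => ∃ a : A, x 0 = Sum.inl a

/-- The annotated disjoint union of two structures for a relational vocabulary. -/
@[reducible] def annotatedSum {L : FirstOrder.Language.{p, q}} [L.IsRelational] (A B : Type u)
    [L.Structure A] [L.Structure B] : (annotate L).Structure (A ⊕ B) where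
  funMap f _ := Sum.elim (fun g => isEmptyElim g) (fun g => Empty.elim g) f
  RelMap R x := annotatedRel A B R x

/-- Quantifier-free scalar `(L, L')`-interpretations. -/
structure Interpretation (L L' : FirstOrder.Language.{p, q}) where
  /-- the formula defining the universe -/
  univ : Formula.{p, q, w} L 1
  univ_qf : univ.IsQF
  /-- the formulas defining the relations -/
  rel : ∀ {k : ℕ}, L'.Relations k → Formula.{p, q, w} L k
  rel_qf : ∀ {k : ℕ} (R : L'.Relations k), (rel R).IsQF

namespace Interpretation

variable {L L' : FirstOrder.Language.{p, q}}

/-- The universe of the interpreted structure. -/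
abbrev Carrier (Ξ : Interpretation.{p, q, w} L L') (M : Type u) [L.Structure M] : Type u :=
  {a : M // Ξ.univ.Realize (fun _ => a)}

/-- The interpreted structure. -/
@[reducible] def str [L'.IsRelational] (Ξ : Interpretation.{p, q, w} L L') (M : Type u)
    [L.Structure M] : L'.Structure (Ξ.Carrier M) where
  funMap f _ := isEmptyElim f
  RelMap R x := (Ξ.rel R).Realize (fun i => (x i).1)

/-- The value `Ξ(A ⊎ B)` of the binary operation defined by `Ξ`, where `A ⊎ B` is the annotated
disjoint union. -/
def sumOp [L.IsRelational] (Ξ : Interpretation.{p, q, w} (annotate L) L)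
    (A B : CategoryTheory.Bundled.{u} L.Structure) : CategoryTheory.Bundled.{u} L.Structure :=
  letI := A.str
  letI := B.str
  letI := annotatedSum (L := L) A.α B.α
  ⟨Ξ.Carrier (A.α ⊕ B.α), Ξ.str (A.α ⊕ B.α)⟩

end Interpretation

/-- A binary operation on `L`-structures is quantifier-free sum-like if, up to isomorphism, it is
given by a quantifier-free scalar interpretation in the annotated disjoint union. -/
def IsQFSumLike {L : FirstOrder.Language.{p, q}} [L.IsRelational]
    (op : CategoryTheory.Bundled.{u} L.Structure → CategoryTheory.Bundled.{u} L.Structure → CategoryTheory.Bundled.{u} L.Structure) : Prop :=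
  ∃ Ξ : Interpretation.{p, q, w} (annotate L) L, ∀ A B : CategoryTheory.Bundled.{u} L.Structure,
    letI := (op A B).str
    letI := (Ξ.sumOp A B).str
    Nonempty ((op A B).α ≃[L] (Ξ.sumOp A B).α)

/-! ### Reduction sequences -/

/-- Propositional formulas over the variables `X`, built with conjunctions and disjunctions of
arbitrary arity. -/
inductive PropFormula (X : Type w) : Type (w + 1)
  | var (x : X) : PropFormula X
  | conj (I : Type w) (β : I → PropFormula X) : PropFormula X
  | disj (I : Type w) (β : I → PropFormula X) : PropFormula X

/-- Truth of a propositional formula under an assignment. -/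
def PropFormula.Eval {X : Type w} (ζ : X → Bool) : PropFormula X → Prop
  | .var x => ζ x = true
  | .conj _ β => ∀ i, Eval ζ (β i)
  | .disj _ β => ∃ i, Eval ζ (β i)

/-- Reduction sequences of sentences: two families of sentences over the same index set `I`, and a
propositional formula in the variables `X_{i,1} = Sum.inl i` and `X_{i,2} = Sum.inr i`. -/
structure ReductionSequence (L : FirstOrder.Language.{p, q}) where
  I : Type w
  Δ₁ : I → Formula.{p, q, w} L 0
  Δ₂ : I → Formula.{p, q, w} L 0
  β : PropFormula (I ⊕ I)

/-- Truth of a sentence in a bundled structure. -/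
def Models {L : FirstOrder.Language.{p, q}} (A : CategoryTheory.Bundled.{u} L.Structure) (φ : Formula.{p, q, w} L 0) : Prop :=
  letI := A.str
  φ.Realize (M := A.α) Fin.elim0

namespace ReductionSequence

variable {L : FirstOrder.Language.{p, q}}

/-- The reduction sequence consists of sentences of the logic `𝓛`. -/
def Over (D : ReductionSequence.{p, q, w} L) (𝓛 : Set (Formula.{p, q, w} L 0)) : Prop :=
  ∀ i, D.Δ₁ i ∈ 𝓛 ∧ D.Δ₂ i ∈ 𝓛

/-- `(A, B)` is a model of the reduction sequence. -/
def IsModel (D : ReductionSequence.{p, q, w} L) (A B : CategoryTheory.Bundled.{u} L.Structure) : Prop :=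
  ∃ ζ : D.I ⊕ D.I → Bool, D.β.Eval ζ ∧
    ∀ i, (ζ (Sum.inl i) = true ↔ Models A (D.Δ₁ i)) ∧ (ζ (Sum.inr i) = true ↔ Models B (D.Δ₂ i))

/-- The reduction sequence is a Feferman–Vaught decomposition of the sentence `φ` over `op`. -/
def IsFVDecomposition (D : ReductionSequence.{p, q, w} L)
    (op : CategoryTheory.Bundled.{u} L.Structure → CategoryTheory.Bundled.{u} L.Structure → CategoryTheory.Bundled.{u} L.Structure)
    (φ : Formula.{p, q, w} L 0) : Prop :=
  ∀ A B : CategoryTheory.Bundled.{u} L.Structure, Models (op A B) φ ↔ D.IsModel A B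

end ReductionSequence

end FVaught

namespace FVaught

/-! ### Cardinal bounds -/

/-! Fix which free variables of a `Σ̃` formula are evaluated on the left and which on the right. Its
truth in the combined structure is then a disjunction of conjunctions `Ψ j` (about the left) ∧ `X j`
(about the right), with `Ψ j` and `X j` again `Σ̃` of the same level and no larger rank. This is
`hasDNF_realizeInSum`, proved by induction on the level.

An element of the disjoint union lies on one side, so `∃` splits into two cases. In each it passes
through the disjunction and lands on the one factor that mentions the new element. The level does
not change and the number of clauses at most adds up.

For a conjunction of lower-level `Π̃` formulas, the negations of the conjuncts are `Σ̃` and have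
disjunctive normal forms by induction; negating these gives conjunctive normal forms, whose clauses
are pooled. `HasCNF.hasDNF` then distributes: a subset of the clauses is assigned to the left
structure, its complement to the right. Each constituent is a conjunction of `Π̃` formulas, hence
`Σ̃`, and the number of disjuncts is an exponential. One exponential per level is what `tower`
provides (`exists_regular_bound`); for `κ = ω` all normal forms stay finite.

The `Π̃` statement follows by negation, and the version for `∞` because `rho κ lam` is again an
infinite cardinal. -/

theorem tower_zero (κ : Cardinal.{w}) : tower 0 κ = κ :=
  Ordinal.limitRecOn_zero ..

theorem tower_add_one (lam : Ordinal.{w}) (κ : Cardinal.{w}) :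
    tower (lam + 1) κ = 2 ^ tower lam κ :=
  Ordinal.limitRecOn_add_one ..

theorem tower_limit {lam : Ordinal.{w}} (h : Order.IsSuccLimit lam) (κ : Cardinal.{w}) :
    tower lam κ = 2 ^ (⨆ a : Set.Iio lam, tower a.1 κ) :=
  Ordinal.limitRecOn_limit _ _ _ _ h

theorem le_iSup_tower {lam l : Ordinal.{w}} (h : l < lam) (κ : Cardinal.{w}) :
    tower l κ ≤ ⨆ a : Set.Iio lam, tower a.1 κ :=
  le_ciSup (f := fun a : Set.Iio lam => tower a.1 κ) Cardinal.bddAbove_of_small ⟨l, h⟩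

/-- Every value of the tower at a positive ordinal is a power of two whose exponent bounds all
earlier values. -/
theorem exists_tower_eq_two_power (κ : Cardinal.{w}) {lam : Ordinal.{w}} (hlam : 0 < lam) :
    ∃ t : Cardinal.{w}, tower lam κ = 2 ^ t ∧ ∀ l < lam, tower l κ ≤ t := by
  induction lam using Ordinal.limitRecOn with
  | zero => exact absurd hlam (lt_irrefl _)
  | add_one o ih =>
    refine ⟨tower o κ, tower_add_one o κ, fun l hl => ?_⟩
    rcases (Order.lt_add_one_iff.1 hl).eq_or_lt with rfl | hlo
    · exact le_rfl
    -- Since `o` is positive too, its value is some `2 ^ t` with all earlier values at most `t`, and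
    -- `t < 2 ^ t`.
    · obtain ⟨t, ht, hle⟩ := ih (zero_le.trans_lt hlo)
      rw [ht]
      exact (hle l hlo).trans (Cardinal.cantor t).le
  | limit o ho _ => exact ⟨_, tower_limit ho κ, fun l hl => le_iSup_tower hl κ⟩

/-- A strict bound for the number of clauses in the normal forms of formulas of level `lam`. -/
noncomputable def clauseBound (κ : Cardinal.{w}) (lam : Ordinal.{w}) : Cardinal.{w} :=
  open Classical in if ℵ₀ < κ then Order.succ (tower lam κ) else ℵ₀

theorem rho_le_clauseBound (κ : Cardinal.{w}) (lam : Ordinal.{w}) :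
    rho κ lam ≤ clauseBound κ lam := by
  unfold rho clauseBound
  split_ifs
  · exact Order.le_succ _
  · exact le_rfl

/-- The cardinal `c` controls the conjunctive normal form at level `lam`. Regularity allows the
clauses of fewer than `κ` lower-level forms to be pooled, `c ≤ rho κ lam` makes conjunctions of
fewer than `c` formulas admissible, and the last property bounds the cost of distributing. -/
theorem exists_regular_bound {κ : Cardinal.{w}} (hκ : ℵ₀ ≤ κ) {lam : Ordinal.{w}} (hlam : 0 < lam) :
    ∃ c : Cardinal.{w}, c.IsRegular ∧ κ ≤ c ∧ c ≤ rho κ lam ∧ (∀ l < lam, clauseBound κ l ≤ c) ∧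
      ∀ s < c, 2 ^ s < clauseBound κ lam := by
  unfold rho clauseBound
  split_ifs with h
  · obtain ⟨t, ht, hle⟩ := exists_tower_eq_two_power κ hlam
    have hκt : κ ≤ t := by simpa [tower_zero] using hle 0 hlam
    -- With the tower value equal to `2 ^ t`, the successor of `t` is regular and at most `2 ^ t`;
    -- any `s` below it satisfies `s ≤ t`, so `2 ^ s ≤ 2 ^ t`.
    refine ⟨Order.succ t, Cardinal.isRegular_succ (hκ.trans hκt), hκt.trans (Order.le_succ t), ?_,
      fun l hl => Order.succ_le_succ (hle l hl), fun s hs => ?_⟩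
    · rw [ht]
      exact Order.succ_le_of_lt (Cardinal.cantor t)
    · rw [ht]
      exact Order.lt_succ_of_le
        (Cardinal.power_le_power_left two_ne_zero (Order.le_of_lt_succ hs))
  · exact ⟨ℵ₀, Cardinal.isRegular_aleph0, not_lt.1 h, le_rfl, fun _ _ => le_rfl,
      fun s hs => Cardinal.power_lt_aleph0 (Cardinal.natCast_lt_aleph0 (n := 2)) hs⟩

theorem aleph0_le_tower {κ : Cardinal.{w}} (hκ : ℵ₀ ≤ κ) (lam : Ordinal.{w}) :
    ℵ₀ ≤ tower lam κ := by
  rcases eq_or_ne lam 0 with rfl | h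
  · rwa [tower_zero]
  · obtain ⟨t, ht, hle⟩ := exists_tower_eq_two_power κ (pos_iff_ne_zero.2 h)
    rw [ht]
    have := hle 0 (pos_iff_ne_zero.2 h)
    rw [tower_zero] at this
    exact (hκ.trans this).trans (Cardinal.cantor t).le

theorem aleph0_le_rho (κ : Cardinal.{w}) (lam : Ordinal.{w}) : ℵ₀ ≤ rho κ lam := by
  unfold rho
  split_ifs with h
  · exact aleph0_le_tower h.le lam
  · exact le_rfl

/-! ### Negation -/

namespace Formula

variable {L : FirstOrder.Language.{p, q}}

/-- The negation normal form of the negation of a formula. -/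
def neg : {n : ℕ} → Formula.{p, q, w} L n → Formula.{p, q, w} L n
  | _, rel R x => nrel R x
  | _, nrel R x => rel R x
  | _, eq x y => neq x y
  | _, neq x y => eq x y
  | _, conj I φ => disj I fun i => neg (φ i)
  | _, disj I φ => conj I fun i => neg (φ i)
  | _, ex φ => all (neg φ)
  | _, all φ => ex (neg φ)

theorem realize_neg {M : Type u} [L.Structure M] {n : ℕ} (φ : Formula.{p, q, w} L n)
    (v : Fin n → M) : φ.neg.Realize v ↔ ¬ φ.Realize v := by
  induction φ with
  | rel | nrel | eq | neq => simp [neg, Realize]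
  | conj I φ ih | disj I φ ih | ex φ ih | all φ ih => simp [neg, Realize, ih]

theorem rank_neg {n : ℕ} (φ : Formula.{p, q, w} L n) : φ.neg.rank = φ.rank := by
  induction φ with
  | rel | nrel | eq | neq => rfl
  | conj I φ ih | disj I φ ih | ex φ ih | all φ ih => simp [neg, rank, ih]

theorem IsQF.neg {n : ℕ} {φ : Formula.{p, q, w} L n} (h : φ.IsQF) : φ.neg.IsQF := by
  induction h with
  | rel R x => exact .nrel R x
  | nrel R x => exact .rel R x
  | eq x y => exact .neq x y
  | neq x y => exact .eq x y
  | conj I hI φ _ ih => exact .disj I hI _ ih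
  | disj I hI φ _ ih => exact .conj I hI _ ih

theorem IsQF.rank_eq_zero {n : ℕ} {φ : Formula.{p, q, w} L n} (h : φ.IsQF) : φ.rank = 0 := by
  induction h with
  | rel | nrel | eq | neq => rfl
  | conj I hI φ _ ih | disj I hI φ _ ih => exact le_antisymm (ciSup_le' fun i => (ih i).le) zero_le

theorem rank_le_rank_conj {n : ℕ} {I : Type w} (φ : I → Formula.{p, q, w} L n) (i : I) :
    (φ i).rank ≤ (conj I φ).rank :=
  le_ciSup (f := fun i => (φ i).rank) Cardinal.bddAbove_of_small i

theorem rank_conj_le {n : ℕ} {I : Type w} {φ : I → Formula.{p, q, w} L n} {r : Cardinal.{w}}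
    (h : ∀ i, (φ i).rank ≤ r) : (conj I φ).rank ≤ r :=
  ciSup_le' h

/-- Needed because a sum-like operation is given by an interpretation only up to isomorphism. -/
theorem realize_equiv {M N : Type u} [L.Structure M] [L.Structure N] (f : M ≃[L] N) {n : ℕ}
    (φ : Formula.{p, q, w} L n) (v : Fin n → M) : φ.Realize (fun i => f (v i)) ↔ φ.Realize v := by
  induction φ with
  | rel R x => exact f.map_rel R fun i => v (x i)
  | nrel R x => exact not_congr (f.map_rel R fun i => v (x i))
  | eq x y => exact f.injective.eq_iff
  | neq x y => exact f.injective.ne_iff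
  | conj I φ ih => exact forall_congr' fun i => ih i v
  | disj I φ ih => exact exists_congr fun i => ih i v
  | @ex k φ ih =>
    refine (f.toEquiv.exists_congr fun a => ?_).symm
    rw [← ih]
    refine iff_of_eq (congrArg _ (funext fun i => ?_))
    refine Fin.lastCases ?_ (fun i => ?_) i
    · simp only [Fin.snoc_last]; rfl
    · simp only [Fin.snoc_castSucc]
  | @all k φ ih =>
    refine (f.toEquiv.forall_congr fun a => ?_).symm
    rw [← ih]
    refine iff_of_eq (congrArg _ (funext fun i => ?_))
    refine Fin.lastCases ?_ (fun i => ?_) i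
    · simp only [Fin.snoc_last]; rfl
    · simp only [Fin.snoc_castSucc]

end Formula

/-- Exchanging the two kinds of classes. -/
def Kind.dual : Kind → Kind
  | sigma => pi
  | pi => sigma

variable {L : FirstOrder.Language.{p, q}}

theorem InClass.neg {κ : Cardinal.{w}} {K : Kind} {lam : Ordinal.{w}} {n : ℕ}
    {φ : Formula.{p, q, w} L n} (h : InClass κ K lam φ) : InClass κ K.dual lam φ.neg := by
  induction h with
  | qf K φ h => exact .qf _ _ h.neg
  | sigma_conj hlam I hI l hl γ _ ih => exact .pi_disj hlam I hI l hl _ ih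
  | sigma_ex hlam φ _ ih => exact .pi_all hlam _ ih
  | pi_disj hlam I hI l hl γ _ ih => exact .sigma_conj hlam I hI l hl _ ih
  | pi_all hlam φ _ ih => exact .sigma_ex hlam _ ih

theorem InClass.mono {κ κ' : Cardinal.{w}} (hκ : κ ≤ κ') {K : Kind} {lam : Ordinal.{w}} {n : ℕ}
    {φ : Formula.{p, q, w} L n} (h : InClass κ K lam φ) : InClass κ' K lam φ := by
  induction h with
  | qf K φ h => exact .qf _ _ h
  | sigma_conj hlam I hI l hl γ _ ih => exact .sigma_conj hlam I (hI.trans_le hκ) l hl _ ih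
  | sigma_ex hlam φ _ ih => exact .sigma_ex hlam _ ih
  | pi_disj hlam I hI l hl γ _ ih => exact .pi_disj hlam I (hI.trans_le hκ) l hl _ ih
  | pi_all hlam φ _ ih => exact .pi_all hlam _ ih

/-! ### Normal forms of properties of pairs of structures -/

/-- Properties of pairs of structures with distinguished tuples. -/
def PairProp (L : FirstOrder.Language.{p, q}) (m₁ m₂ : ℕ) : Type (max p q (u + 1)) :=
  ∀ (A B : Type u) [L.Structure A] [L.Structure B], (Fin m₁ → A) → (Fin m₂ → B) → Prop

/-- `P` is a disjunction of fewer than `c` conjunctions of a formula from `C` on the left structure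
and a formula from `C` on the right structure. -/
def HasDNF (C : ∀ {n : ℕ}, Formula.{p, q, w} L n → Prop) (c : Cardinal.{w}) {m₁ m₂ : ℕ}
    (P : PairProp.{p, q, u} L m₁ m₂) : Prop :=
  ∃ (J : Type w) (Ψ : J → Formula.{p, q, w} L m₁) (X : J → Formula.{p, q, w} L m₂), #J < c ∧
    (∀ j, C (Ψ j)) ∧ (∀ j, C (X j)) ∧
    ∀ (A B : Type u) [L.Structure A] [L.Structure B] (v₁ : Fin m₁ → A) (v₂ : Fin m₂ → B),
      P A B v₁ v₂ ↔ ∃ j, (Ψ j).Realize v₁ ∧ (X j).Realize v₂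

/-- `P` is a conjunction of fewer than `c` disjunctions of a formula from `C` on the left structure
and a formula from `C` on the right structure. -/
def HasCNF (C : ∀ {n : ℕ}, Formula.{p, q, w} L n → Prop) (c : Cardinal.{w}) {m₁ m₂ : ℕ}
    (P : PairProp.{p, q, u} L m₁ m₂) : Prop :=
  ∃ (J : Type w) (Ψ : J → Formula.{p, q, w} L m₁) (X : J → Formula.{p, q, w} L m₂), #J < c ∧
    (∀ j, C (Ψ j)) ∧ (∀ j, C (X j)) ∧
    ∀ (A B : Type u) [L.Structure A] [L.Structure B] (v₁ : Fin m₁ → A) (v₂ : Fin m₂ → B),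
      P A B v₁ v₂ ↔ ∀ j, (Ψ j).Realize v₁ ∨ (X j).Realize v₂

section

variable {C C' : ∀ {n : ℕ}, Formula.{p, q, w} L n → Prop} {c c' : Cardinal.{w}} {m₁ m₂ : ℕ}
  {P Q : PairProp.{p, q, u} L m₁ m₂}

theorem HasDNF.congr (h : HasDNF C c P)
    (hPQ : ∀ (A B : Type u) [L.Structure A] [L.Structure B] v₁ v₂, Q A B v₁ v₂ ↔ P A B v₁ v₂) :
    HasDNF C c Q := by
  obtain ⟨J, Ψ, X, hJ, hΨ, hX, h⟩ := h
  exact ⟨J, Ψ, X, hJ, hΨ, hX, fun A B _ _ v₁ v₂ => (hPQ A B v₁ v₂).trans (h A B v₁ v₂)⟩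

theorem HasDNF.mono (h : HasDNF C c P) (hc : c ≤ c')
    (hC : ∀ {n : ℕ} (φ : Formula.{p, q, w} L n), C φ → C' φ) : HasDNF C' c' P := by
  obtain ⟨J, Ψ, X, hJ, hΨ, hX, h⟩ := h
  exact ⟨J, Ψ, X, hJ.trans_le hc, fun j => hC _ (hΨ j), fun j => hC _ (hX j), h⟩

theorem HasCNF.mono (h : HasCNF C c P) (hc : c ≤ c')
    (hC : ∀ {n : ℕ} (φ : Formula.{p, q, w} L n), C φ → C' φ) : HasCNF C' c' P := by
  obtain ⟨J, Ψ, X, hJ, hΨ, hX, h⟩ := h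
  exact ⟨J, Ψ, X, hJ.trans_le hc, fun j => hC _ (hΨ j), fun j => hC _ (hX j), h⟩

theorem HasDNF.not (h : HasDNF C c P)
    (hC : ∀ {n : ℕ} (φ : Formula.{p, q, w} L n), C φ → C' φ.neg) :
    HasCNF C' c (fun A B _ _ v₁ v₂ => ¬ P A B v₁ v₂ : PairProp.{p, q, u} L m₁ m₂) := by
  obtain ⟨J, Ψ, X, hJ, hΨ, hX, h⟩ := h
  refine ⟨J, fun j => (Ψ j).neg, fun j => (X j).neg, hJ, fun j => hC _ (hΨ j),
    fun j => hC _ (hX j), fun A B _ _ v₁ v₂ => ?_⟩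
  simp only [h, Formula.realize_neg, not_exists, not_and_or]

/-- The clauses of all the forms are collected in one disjoint union; regularity of `c` keeps their
number below `c`. -/
theorem HasCNF.forall {I : Type w} {P : I → PairProp.{p, q, u} L m₁ m₂} (hc : c.IsRegular)
    (hI : #I < c) (h : ∀ i, HasCNF C c (P i)) :
    HasCNF C c (fun A B _ _ v₁ v₂ => ∀ i, P i A B v₁ v₂ : PairProp.{p, q, u} L m₁ m₂) := by
  choose J Ψ X hJ hΨ hX h using h
  refine ⟨Σ i, J i, fun j => Ψ j.1 j.2, fun j => X j.1 j.2, ?_, fun j => hΨ _ _, fun j => hX _ _,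
    fun A B _ _ v₁ v₂ => ?_⟩
  · rw [Cardinal.mk_sigma]
    exact Cardinal.sum_lt_of_isRegular hc hI hJ
  · simp only [h, Sigma.forall]

theorem HasCNF.and (hc : ℵ₀ ≤ c) (hP : HasCNF C c P) (hQ : HasCNF C c Q) :
    HasCNF C c (fun A B _ _ v₁ v₂ => P A B v₁ v₂ ∧ Q A B v₁ v₂ : PairProp.{p, q, u} L m₁ m₂) := by
  obtain ⟨J, Ψ, X, hJ, hΨ, hX, h⟩ := hP
  obtain ⟨J', Ψ', X', hJ', hΨ', hX', h'⟩ := hQ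
  refine ⟨J ⊕ J', Sum.elim Ψ Ψ', Sum.elim X X', ?_, ?_, ?_, fun A B _ _ v₁ v₂ => ?_⟩
  · rw [Cardinal.mk_sum, Cardinal.lift_id, Cardinal.lift_id]
    exact Cardinal.add_lt_of_lt hc hJ hJ'
  · rintro (j | j)
    exacts [hΨ j, hΨ' j]
  · rintro (j | j)
    exacts [hX j, hX' j]
  · simp only [h, h', Sum.forall, Sum.elim_inl, Sum.elim_inr]

theorem HasDNF.or (hc : ℵ₀ ≤ c) (hP : HasDNF C c P) (hQ : HasDNF C c Q) :
    HasDNF C c (fun A B _ _ v₁ v₂ => P A B v₁ v₂ ∨ Q A B v₁ v₂ : PairProp.{p, q, u} L m₁ m₂) := by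
  obtain ⟨J, Ψ, X, hJ, hΨ, hX, h⟩ := hP
  obtain ⟨J', Ψ', X', hJ', hΨ', hX', h'⟩ := hQ
  refine ⟨J ⊕ J', Sum.elim Ψ Ψ', Sum.elim X X', ?_, ?_, ?_, fun A B _ _ v₁ v₂ => ?_⟩
  · rw [Cardinal.mk_sum, Cardinal.lift_id, Cardinal.lift_id]
    exact Cardinal.add_lt_of_lt hc hJ hJ'
  · rintro (j | j)
    exacts [hΨ j, hΨ' j]
  · rintro (j | j)
    exacts [hX j, hX' j]
  · simp only [h, h', Sum.exists, Sum.elim_inl, Sum.elim_inr]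

/-- Distributing a conjunction of disjunctions over all ways of assigning the conjuncts to the two
structures. -/
theorem HasCNF.hasDNF (h : HasCNF C c P)
    (hC : ∀ {n : ℕ} (I : Type w) (γ : I → Formula.{p, q, w} L n), #I < c → (∀ i, C (γ i)) →
      C' (Formula.conj I γ))
    (hc : ∀ s < c, 2 ^ s < c') : HasDNF C' c' P := by
  obtain ⟨J, Ψ, X, hJ, hΨ, hX, h⟩ := h
  refine ⟨Set J, fun S => .conj S fun j => Ψ j, fun S => .conj (Sᶜ : Set J) fun j => X j, ?_,
    fun S => hC _ _ ((Cardinal.mk_set_le S).trans_lt hJ) fun j => hΨ j,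
    fun S => hC _ _ ((Cardinal.mk_set_le _).trans_lt hJ) fun j => hX j,
    fun A B _ _ v₁ v₂ => ?_⟩
  · rw [Cardinal.mk_set]
    exact hc _ hJ
  · rw [h]
    simp only [Formula.Realize, Subtype.forall, Set.mem_compl_iff]
    constructor
    -- The left structure receives exactly the clauses that it satisfies; the right one must satisfy
    -- the rest.
    · exact fun H => ⟨{j | (Ψ j).Realize v₁}, fun j hj => hj, fun j hj => (H j).resolve_left hj⟩
    · rintro ⟨S, h₁, h₂⟩ j
      by_cases hj : j ∈ S
      exacts [.inl (h₁ j hj), .inr (h₂ j hj)]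

end

/-! ### Quantifier-free properties -/

section QF

variable {m₁ m₂ : ℕ}

/-- Properties with a finite normal form consisting of quantifier-free formulas. -/
abbrev IsQFPair (P : PairProp.{p, q, u} L m₁ m₂) : Prop :=
  HasDNF.{p, q, w, u} (fun φ => φ.IsQF) ℵ₀ P

variable {P Q : PairProp.{p, q, u} L m₁ m₂}

/-- A finite set has finitely many subsets, so finite quantifier-free normal forms of both shapes
are interchangeable. This makes such properties closed under Boolean operations. -/
theorem HasCNF.isQFPair (h : HasCNF.{p, q, w, u} (fun φ => φ.IsQF) ℵ₀ P) :
    IsQFPair.{p, q, w, u} P :=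
  h.hasDNF (fun I γ hI h => .conj I (Cardinal.lt_aleph0_iff_finite.1 hI) γ h)
    fun _ hs => Cardinal.power_lt_aleph0 (Cardinal.natCast_lt_aleph0 (n := 2)) hs

theorem IsQFPair.not (h : IsQFPair.{p, q, w, u} P) :
    IsQFPair.{p, q, w, u} (fun A B _ _ v₁ v₂ => ¬ P A B v₁ v₂ : PairProp.{p, q, u} L m₁ m₂) :=
  (HasDNF.not h fun _ => Formula.IsQF.neg).isQFPair

theorem IsQFPair.hasCNF (h : IsQFPair.{p, q, w, u} P) :
    HasCNF.{p, q, w, u} (fun φ => φ.IsQF) ℵ₀ P := by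
  have := HasDNF.not h.not (C' := fun φ => φ.IsQF) fun _ => Formula.IsQF.neg
  simpa only [not_not] using this

theorem IsQFPair.forall {I : Type w} (hI : Finite I) {P : I → PairProp.{p, q, u} L m₁ m₂}
    (h : ∀ i, IsQFPair.{p, q, w, u} (P i)) :
    IsQFPair.{p, q, w, u}
      (fun A B _ _ v₁ v₂ => ∀ i, P i A B v₁ v₂ : PairProp.{p, q, u} L m₁ m₂) :=
  (HasCNF.forall Cardinal.isRegular_aleph0 (Cardinal.lt_aleph0_iff_finite.2 hI)
    fun i => (h i).hasCNF).isQFPair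

theorem IsQFPair.exists {I : Type w} (hI : Finite I) {P : I → PairProp.{p, q, u} L m₁ m₂}
    (h : ∀ i, IsQFPair.{p, q, w, u} (P i)) :
    IsQFPair.{p, q, w, u}
      (fun A B _ _ v₁ v₂ => ∃ i, P i A B v₁ v₂ : PairProp.{p, q, u} L m₁ m₂) :=
  (IsQFPair.forall hI fun i => (h i).not).not.congr fun A B _ _ v₁ v₂ => by simp

theorem IsQFPair.and (hP : IsQFPair.{p, q, w, u} P) (hQ : IsQFPair.{p, q, w, u} Q) :
    IsQFPair.{p, q, w, u}
      (fun A B _ _ v₁ v₂ => P A B v₁ v₂ ∧ Q A B v₁ v₂ : PairProp.{p, q, u} L m₁ m₂) :=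
  (HasCNF.and le_rfl hP.hasCNF hQ.hasCNF).isQFPair

theorem isQFPair_left {φ : Formula.{p, q, w} L m₁} (h : φ.IsQF) :
    IsQFPair.{p, q, w, u}
      (fun _ _ _ _ v₁ _ => φ.Realize v₁ : PairProp.{p, q, u} L m₁ m₂) :=
  -- A single clause whose right factor is the empty conjunction, that is, True.
  ⟨PUnit, fun _ => φ, fun _ => .conj PEmpty fun i => i.elim, Cardinal.lt_aleph0_of_finite _,
    fun _ => h, fun _ => .conj _ inferInstance _ fun i => i.elim,
    fun A B _ _ v₁ v₂ => by simp [Formula.Realize]⟩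

theorem isQFPair_right {φ : Formula.{p, q, w} L m₂} (h : φ.IsQF) :
    IsQFPair.{p, q, w, u}
      (fun _ _ _ _ _ v₂ => φ.Realize v₂ : PairProp.{p, q, u} L m₁ m₂) :=
  ⟨PUnit, fun _ => .conj PEmpty fun i => i.elim, fun _ => φ, Cardinal.lt_aleph0_of_finite _,
    fun _ => .conj _ inferInstance _ fun i => i.elim, fun _ => h,
    fun A B _ _ v₁ v₂ => by simp [Formula.Realize]⟩

theorem isQFPair_const (a : Prop) :
    IsQFPair.{p, q, w, u} (fun _ _ _ _ _ _ => a : PairProp.{p, q, u} L m₁ m₂) := by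
  have h := isQFPair_left.{p, q, w, u} (m₂ := m₂) (Formula.IsQF.conj (L := L) (n := m₁) PEmpty
    inferInstance (fun i => i.elim) fun i => i.elim)
  by_cases ha : a
  · exact h.congr fun A B _ _ v₁ v₂ => by simp [Formula.Realize, ha]
  · exact h.not.congr fun A B _ _ v₁ v₂ => by simp [Formula.Realize, ha]

end QF

/-! ### Translating formulas through an interpretation in an annotated disjoint union -/

section Translation

variable {n m₁ m₂ : ℕ}

attribute [local instance] annotatedSum Interpretation.str

/-- The tuple in a disjoint union with coordinates prescribed by `e`. -/
def sumTuple {A B : Type u} (e : Fin n → Fin m₁ ⊕ Fin m₂) (v₁ : Fin m₁ → A) (v₂ : Fin m₂ → B) :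
    Fin n → A ⊕ B :=
  fun i => Sum.map v₁ v₂ (e i)

/-- The coordinates after adding a new variable on the left. -/
def snocLeft (e : Fin n → Fin m₁ ⊕ Fin m₂) : Fin (n + 1) → Fin (m₁ + 1) ⊕ Fin m₂ :=
  Fin.snoc (α := fun _ => Fin (m₁ + 1) ⊕ Fin m₂) (fun i => Sum.map Fin.castSucc id (e i))
    (.inl (Fin.last m₁))

/-- The coordinates after adding a new variable on the right. -/
def snocRight (e : Fin n → Fin m₁ ⊕ Fin m₂) : Fin (n + 1) → Fin m₁ ⊕ Fin (m₂ + 1) :=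
  Fin.snoc (α := fun _ => Fin m₁ ⊕ Fin (m₂ + 1)) (fun i => Sum.map id Fin.castSucc (e i))
    (.inr (Fin.last m₂))

theorem sumTuple_snocLeft {A B : Type u} (e : Fin n → Fin m₁ ⊕ Fin m₂) (v₁ : Fin m₁ → A)
    (v₂ : Fin m₂ → B) (a : A) :
    sumTuple (snocLeft e) (Fin.snoc (α := fun _ => A) v₁ a) v₂ =
      Fin.snoc (α := fun _ => A ⊕ B) (sumTuple e v₁ v₂) (.inl a) := by
  funext i
  refine Fin.lastCases ?_ (fun i => ?_) i
  · simp [sumTuple, snocLeft]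
  · cases h : e i <;> simp [sumTuple, snocLeft, h]

theorem sumTuple_snocRight {A B : Type u} (e : Fin n → Fin m₁ ⊕ Fin m₂) (v₁ : Fin m₁ → A)
    (v₂ : Fin m₂ → B) (b : B) :
    sumTuple (snocRight e) v₁ (Fin.snoc (α := fun _ => B) v₂ b) =
      Fin.snoc (α := fun _ => A ⊕ B) (sumTuple e v₁ v₂) (.inr b) := by
  funext i
  refine Fin.lastCases ?_ (fun i => ?_) i
  · simp [sumTuple, snocRight]
  · cases h : e i <;> simp [sumTuple, snocRight, h]

/-- Whether all arguments lie on the left is decided by `e` alone. If they do, the property is an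
atomic formula on the left; otherwise it is identically false. -/
theorem isQFPair_rel_left (e : Fin n → Fin m₁ ⊕ Fin m₂) {k : ℕ} (R : L.Relations k)
    (x : Fin k → Fin n) :
    IsQFPair.{p, q, w, u} (fun A _ _ _ v₁ v₂ => ∃ a : Fin k → A,
      (fun i => sumTuple e v₁ v₂ (x i)) = (fun i => Sum.inl (a i)) ∧
        FirstOrder.Language.Structure.RelMap R a : PairProp.{p, q, u} L m₁ m₂) := by
  by_cases hy : ∃ y : Fin k → Fin m₁, ∀ i, e (x i) = .inl (y i)
  · obtain ⟨y, hy⟩ := hy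
    refine (isQFPair_left (Formula.IsQF.rel R y)).congr fun A B _ _ v₁ v₂ => ?_
    simp only [sumTuple, hy, Sum.map_inl, Formula.Realize, funext_iff, Sum.inl.injEq]
    constructor
    · rintro ⟨a, h, ha⟩
      rwa [funext h]
    · exact fun h => ⟨_, fun _ => rfl, h⟩
  · refine (isQFPair_const False).congr fun A B _ _ v₁ v₂ => iff_of_false ?_ id
    rintro ⟨a, h, -⟩
    have : ∀ i, ∃ y, e (x i) = .inl y := fun i => by
      have hi := congrFun h i
      cases he : e (x i) with
      | inl y => exact ⟨y, rfl⟩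
      | inr y => simp [sumTuple, he] at hi
    exact hy (Classical.axiomOfChoice this)

theorem isQFPair_rel_right (e : Fin n → Fin m₁ ⊕ Fin m₂) {k : ℕ} (R : L.Relations k)
    (x : Fin k → Fin n) :
    IsQFPair.{p, q, w, u} (fun _ B _ _ v₁ v₂ => ∃ b : Fin k → B,
      (fun i => sumTuple e v₁ v₂ (x i)) = (fun i => Sum.inr (b i)) ∧
        FirstOrder.Language.Structure.RelMap R b : PairProp.{p, q, u} L m₁ m₂) := by
  by_cases hy : ∃ y : Fin k → Fin m₂, ∀ i, e (x i) = .inr (y i)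
  · obtain ⟨y, hy⟩ := hy
    refine (isQFPair_right (Formula.IsQF.rel R y)).congr fun A B _ _ v₁ v₂ => ?_
    simp only [sumTuple, hy, Sum.map_inr, Formula.Realize, funext_iff, Sum.inr.injEq]
    constructor
    · rintro ⟨a, h, ha⟩
      rwa [funext h]
    · exact fun h => ⟨_, fun _ => rfl, h⟩
  · refine (isQFPair_const False).congr fun A B _ _ v₁ v₂ => iff_of_false ?_ id
    rintro ⟨a, h, -⟩
    have : ∀ i, ∃ y, e (x i) = .inr y := fun i => by
      have hi := congrFun h i
      cases he : e (x i) with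
      | inr y => exact ⟨y, rfl⟩
      | inl y => simp [sumTuple, he] at hi
    exact hy (Classical.axiomOfChoice this)

theorem isQFPair_eq (e : Fin n → Fin m₁ ⊕ Fin m₂) (x y : Fin n) :
    IsQFPair.{p, q, w, u} (fun _ _ _ _ v₁ v₂ =>
      sumTuple e v₁ v₂ x = sumTuple e v₁ v₂ y : PairProp.{p, q, u} L m₁ m₂) := by
  cases hx : e x with
  | inl a =>
    cases hy : e y with
    | inl b =>
      exact (isQFPair_left (.eq a b)).congr fun A B _ _ v₁ v₂ => by
        simp [sumTuple, hx, hy, Formula.Realize]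
    | inr b =>
      exact (isQFPair_const False).congr fun A B _ _ v₁ v₂ => by simp [sumTuple, hx, hy]
  | inr a =>
    cases hy : e y with
    | inl b =>
      exact (isQFPair_const False).congr fun A B _ _ v₁ v₂ => by simp [sumTuple, hx, hy]
    | inr b =>
      exact (isQFPair_right (.eq a b)).congr fun A B _ _ v₁ v₂ => by
        simp [sumTuple, hx, hy, Formula.Realize]

theorem isQFPair_P (e : Fin n → Fin m₁ ⊕ Fin m₂) (x : Fin n) :
    IsQFPair.{p, q, w, u} (fun A _ _ _ v₁ v₂ =>
      ∃ a : A, sumTuple e v₁ v₂ x = .inl a : PairProp.{p, q, u} L m₁ m₂) := by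
  cases hx : e x with
  | inl a => exact (isQFPair_const True).congr fun A B _ _ v₁ v₂ => by simp [sumTuple, hx]
  | inr a => exact (isQFPair_const False).congr fun A B _ _ v₁ v₂ => by simp [sumTuple, hx]

/-- The formulas of a class whose quantifier rank is at most `r`. -/
def RankedClass (κ : Cardinal.{w}) (K : Kind) (lam : Ordinal.{w}) (r : Cardinal.{w}) {n : ℕ}
    (φ : Formula.{p, q, w} L n) : Prop :=
  InClass κ K lam φ ∧ φ.rank ≤ r

/-- The quantifier commutes with the disjunction, and in each clause the right factor does not
mention the new element, so the quantifier moves onto the left factor and no clause is added. -/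
theorem HasDNF.ex {κ c r : Cardinal.{w}} {lam : Ordinal.{w}} (hlam : 0 < lam)
    {P : PairProp.{p, q, u} L (m₁ + 1) m₂}
    (h : HasDNF (RankedClass κ .sigma lam r) c P) :
    HasDNF (RankedClass κ .sigma lam (r + 1)) c (fun A B _ _ v₁ v₂ =>
      ∃ a : A, P A B (Fin.snoc (α := fun _ => A) v₁ a) v₂ : PairProp.{p, q, u} L m₁ m₂) := by
  obtain ⟨J, Ψ, X, hJ, hΨ, hX, h⟩ := h
  refine ⟨J, fun j => .ex (Ψ j), X, hJ, fun j => ⟨.sigma_ex hlam _ (hΨ j).1,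
    add_le_add_left (hΨ j).2 1⟩, fun j => ⟨(hX j).1, (hX j).2.trans le_self_add⟩,
    fun A B _ _ v₁ v₂ => ?_⟩
  simp only [h, Formula.Realize]
  rw [exists_comm]
  simp only [exists_and_right]

theorem HasDNF.ex_right {κ c r : Cardinal.{w}} {lam : Ordinal.{w}} (hlam : 0 < lam)
    {P : PairProp.{p, q, u} L m₁ (m₂ + 1)}
    (h : HasDNF (RankedClass κ .sigma lam r) c P) :
    HasDNF (RankedClass κ .sigma lam (r + 1)) c (fun A B _ _ v₁ v₂ =>
      ∃ b : B, P A B v₁ (Fin.snoc (α := fun _ => B) v₂ b) : PairProp.{p, q, u} L m₁ m₂) := by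
  obtain ⟨J, Ψ, X, hJ, hΨ, hX, h⟩ := h
  refine ⟨J, Ψ, fun j => .ex (X j), hJ, fun j => ⟨(hΨ j).1, (hΨ j).2.trans le_self_add⟩,
    fun j => ⟨.sigma_ex hlam _ (hX j).1, add_le_add_left (hX j).2 1⟩,
    fun A B _ _ v₁ v₂ => ?_⟩
  simp only [h, Formula.Realize]
  rw [exists_comm]
  simp only [exists_and_left]

variable [L.IsRelational]

theorem isQFPair_realize_annotatedSum (e : Fin n → Fin m₁ ⊕ Fin m₂)
    {φ : Formula.{p, q, w} (annotate L) n} (h : φ.IsQF) :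
    IsQFPair.{p, q, w, u} (fun _ _ _ _ v₁ v₂ =>
      φ.Realize (sumTuple e v₁ v₂) : PairProp.{p, q, u} L m₁ m₂) := by
  have hrel : ∀ {k : ℕ} (R : (annotate L).Relations k) (x : Fin k → Fin n),
      IsQFPair.{p, q, w, u} (fun A B _ _ v₁ v₂ =>
        annotatedRel A B R fun i => sumTuple e v₁ v₂ (x i) : PairProp.{p, q, u} L m₁ m₂) := by
    rintro k (R | R) x
    · exact HasDNF.or le_rfl (isQFPair_rel_left e R x) (isQFPair_rel_right e R x)
    · cases R
      exact isQFPair_P e (x 0)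
  induction h with
  | rel R x => exact hrel R x
  | nrel R x => exact (hrel R x).not
  | eq x y => exact isQFPair_eq e x y
  | neq x y => exact (isQFPair_eq e x y).not
  | conj I hI φ _ ih => exact IsQFPair.forall hI fun i => ih i
  | disj I hI φ _ ih => exact IsQFPair.exists hI fun i => ih i

variable (Ξ : Interpretation.{p, q, w} (annotate L) L)

/-- All the coordinates lie in the universe of the interpreted structure. -/
def InUniv (e : Fin n → Fin m₁ ⊕ Fin m₂) : PairProp.{p, q, u} L m₁ m₂ :=
  fun _ _ _ _ v₁ v₂ => ∀ i, Ξ.univ.Realize fun _ => sumTuple e v₁ v₂ i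

/-- The coordinates lie in the universe of the interpreted structure and satisfy `φ` there. -/
def RealizeInSum (e : Fin n → Fin m₁ ⊕ Fin m₂) (φ : Formula.{p, q, w} L n) :
    PairProp.{p, q, u} L m₁ m₂ :=
  fun A B _ _ v₁ v₂ => ∃ v : Fin n → Ξ.Carrier (A ⊕ B),
    (∀ i, (v i).1 = sumTuple e v₁ v₂ i) ∧ φ.Realize v

theorem isQFPair_inUniv (e : Fin n → Fin m₁ ⊕ Fin m₂) :
    IsQFPair.{p, q, w, u} (InUniv.{p, q, w, u} Ξ e) :=
  (IsQFPair.forall (I := ULift.{w} (Fin n)) inferInstance fun i =>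
    isQFPair_realize_annotatedSum (fun _ : Fin 1 => e i.down) Ξ.univ_qf).congr
      fun _ _ _ _ _ _ => ⟨fun h i => h i.down, fun h i => h ⟨i⟩⟩

theorem realizeInSum_iff {e : Fin n → Fin m₁ ⊕ Fin m₂} {φ : Formula.{p, q, w} L n}
    {A B : Type u} [L.Structure A] [L.Structure B] {v₁ : Fin m₁ → A} {v₂ : Fin m₂ → B} :
    RealizeInSum Ξ e φ A B v₁ v₂ ↔ ∃ h : InUniv Ξ e A B v₁ v₂,
      φ.Realize (M := Ξ.Carrier (A ⊕ B)) fun i => ⟨sumTuple e v₁ v₂ i, h i⟩ := by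
  constructor
  · rintro ⟨v, hv, h⟩
    have hU : InUniv Ξ e A B v₁ v₂ := fun i => hv i ▸ (v i).2
    have : v = fun i => ⟨sumTuple e v₁ v₂ i, hU i⟩ := funext fun i => Subtype.ext (hv i)
    exact ⟨hU, this ▸ h⟩
  · rintro ⟨h, hφ⟩
    exact ⟨_, fun i => rfl, hφ⟩

/-- On tuples from the universe, quantifier-free formulas translate to quantifier-free
properties. -/
theorem exists_isQFPair_realize_iff (e : Fin n → Fin m₁ ⊕ Fin m₂) {φ : Formula.{p, q, w} L n}
    (h : φ.IsQF) : ∃ Q : PairProp.{p, q, u} L m₁ m₂, IsQFPair.{p, q, w, u} Q ∧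
      ∀ (A B : Type u) [L.Structure A] [L.Structure B] (v₁ : Fin m₁ → A) (v₂ : Fin m₂ → B)
        (hU : InUniv Ξ e A B v₁ v₂),
        φ.Realize (M := Ξ.Carrier (A ⊕ B)) (fun i => ⟨sumTuple e v₁ v₂ i, hU i⟩) ↔
          Q A B v₁ v₂ := by
  induction h with
  | rel R x =>
    exact ⟨_, isQFPair_realize_annotatedSum (fun i => e (x i)) (Ξ.rel_qf R),
      fun A B _ _ v₁ v₂ hU => Iff.rfl⟩
  | nrel R x =>
    exact ⟨_, (isQFPair_realize_annotatedSum (fun i => e (x i)) (Ξ.rel_qf R)).not,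
      fun A B _ _ v₁ v₂ hU => Iff.rfl⟩
  | eq x y => exact ⟨_, isQFPair_eq e x y, fun A B _ _ v₁ v₂ hU => Subtype.ext_iff⟩
  | neq x y => exact ⟨_, (isQFPair_eq e x y).not, fun A B _ _ v₁ v₂ hU => not_congr Subtype.ext_iff⟩
  | conj I hI φ _ ih =>
    choose Q hQ h using ih
    exact ⟨_, IsQFPair.forall hI hQ,
      fun A B _ _ v₁ v₂ hU => forall_congr' fun i => h i A B v₁ v₂ hU⟩
  | disj I hI φ _ ih =>
    choose Q hQ h using ih
    exact ⟨_, IsQFPair.exists hI hQ,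
      fun A B _ _ v₁ v₂ hU => exists_congr fun i => h i A B v₁ v₂ hU⟩

theorem isQFPair_realizeInSum (e : Fin n → Fin m₁ ⊕ Fin m₂) {φ : Formula.{p, q, w} L n}
    (h : φ.IsQF) : IsQFPair.{p, q, w, u} (RealizeInSum.{p, q, w, u} Ξ e φ) := by
  obtain ⟨Q, hQ, h⟩ := exists_isQFPair_realize_iff.{p, q, w, u} Ξ e h
  refine ((isQFPair_inUniv Ξ e).and hQ).congr fun A B _ _ v₁ v₂ => ?_
  rw [realizeInSum_iff, ← exists_prop]
  exact exists_congr fun hU => h A B v₁ v₂ hU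

/-- `RealizeInSum` also fails for tuples outside the universe, so its failure for `(γ i).neg`
amounts to the truth of `γ i` only under the guard `InUniv`. -/
theorem realizeInSum_conj_iff {e : Fin n → Fin m₁ ⊕ Fin m₂} {I : Type w}
    {γ : I → Formula.{p, q, w} L n}
    {A B : Type u} [L.Structure A] [L.Structure B] {v₁ : Fin m₁ → A} {v₂ : Fin m₂ → B} :
    RealizeInSum Ξ e (.conj I γ) A B v₁ v₂ ↔
      InUniv Ξ e A B v₁ v₂ ∧ ∀ i, ¬ RealizeInSum Ξ e (γ i).neg A B v₁ v₂ := by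
  simp only [realizeInSum_iff, ← exists_prop]
  refine exists_congr fun hU => forall_congr' fun i => ?_
  rw [not_exists, forall_prop_of_true hU, Formula.realize_neg, not_not]

/-- No separate relativization of the quantifier is needed: `RealizeInSum` for the extended tuple
already forces the new element into the universe. -/
theorem realizeInSum_ex_iff {e : Fin n → Fin m₁ ⊕ Fin m₂} {φ : Formula.{p, q, w} L (n + 1)}
    {A B : Type u} [L.Structure A] [L.Structure B] {v₁ : Fin m₁ → A} {v₂ : Fin m₂ → B} :
    RealizeInSum Ξ e (.ex φ) A B v₁ v₂ ↔
      (∃ a : A, RealizeInSum Ξ (snocLeft e) φ A B (Fin.snoc (α := fun _ => A) v₁ a) v₂) ∨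
      ∃ b : B, RealizeInSum Ξ (snocRight e) φ A B v₁ (Fin.snoc (α := fun _ => B) v₂ b) := by
  have key : RealizeInSum Ξ e (.ex φ) A B v₁ v₂ ↔
      ∃ c : A ⊕ B, ∃ v : Fin (n + 1) → Ξ.Carrier (A ⊕ B),
        (∀ i, (v i).1 = Fin.snoc (α := fun _ => A ⊕ B) (sumTuple e v₁ v₂) c i) ∧
          φ.Realize v := by
    constructor
    · rintro ⟨v, hv, c, h⟩
      refine ⟨c.1, _, fun i => ?_, h⟩
      refine Fin.lastCases ?_ (fun i => ?_) i
      · simp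
      · simpa using hv i
    · rintro ⟨c, v, hv, h⟩
      refine ⟨fun i => v i.castSucc, fun i => by simpa using hv i.castSucc, v (Fin.last n), ?_⟩
      have : Fin.snoc (α := fun _ => Ξ.Carrier (A ⊕ B)) (fun i => v i.castSucc) (v (Fin.last n)) =
          v := Fin.snoc_init_self v
      rwa [this]
  rw [key, Sum.exists]
  simp only [RealizeInSum, sumTuple_snocLeft, sumTuple_snocRight]

theorem aleph0_le_clauseBound (κ : Cardinal.{w}) (lam : Ordinal.{w}) : ℵ₀ ≤ clauseBound κ lam :=
  (aleph0_le_rho κ lam).trans (rho_le_clauseBound κ lam)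

/-- Formulas from `Σ̃_{κ,lam}` have a disjunctive normal form whose constituents are formulas from
`Σ̃_{ρ(κ,lam),lam}` of no larger rank. -/
theorem hasDNF_realizeInSum {κ : Cardinal.{w}} (hκ : ℵ₀ ≤ κ) (lam : Ordinal.{w}) :
    ∀ {n m₁ m₂ : ℕ} (e : Fin n → Fin m₁ ⊕ Fin m₂) (φ : Formula.{p, q, w} L n),
      InClass κ .sigma lam φ →
      HasDNF (RankedClass (rho κ lam) .sigma lam φ.rank) (clauseBound κ lam)
        (RealizeInSum.{p, q, w, u} Ξ e φ) := by
  induction lam using WellFoundedLT.induction with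
  | ind lam IH =>
  intro n m₁ m₂ e φ h
  -- Inside the induction on the level, an induction on membership in the class peels off the
  -- quantifier block, which stays at one level.
  generalize hK : Kind.sigma = K at h
  induction h generalizing m₁ m₂ with
  | qf K φ h =>
    subst hK
    exact (isQFPair_realizeInSum Ξ e h).mono (aleph0_le_clauseBound _ _)
      fun ψ hψ => ⟨.qf _ _ hψ, by simp [hψ.rank_eq_zero]⟩
  | @sigma_conj lam hlam n I hI l hl γ hγ _ =>
    obtain ⟨c, hc, hκc, hcρ, hlc, hpow⟩ := exists_regular_bound hκ hlam
    -- The levels of the conjuncts vary, so the clauses are built from `Π̃` formulas of any level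
    -- below `lam`; the quantifier-free guard enters at level `0`.
    let C : ∀ {n : ℕ}, Formula.{p, q, w} L n → Prop := fun ψ =>
      ∃ l < lam, RankedClass (rho κ lam) .pi l (Formula.conj I γ).rank ψ
    have hU : HasCNF (@C) c (InUniv.{p, q, w, u} Ξ e) :=
      (isQFPair_inUniv Ξ e).hasCNF.mono (hκ.trans hκc)
        fun ψ hψ => ⟨0, hlam, .qf _ _ hψ, by simp [hψ.rank_eq_zero]⟩
    have hI' : ∀ i, HasCNF (@C) c (fun A B _ _ v₁ v₂ =>
        ¬ RealizeInSum.{p, q, w, u} Ξ e (γ i).neg A B v₁ v₂) := fun i => by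
      refine ((IH (l i) (hl i) e _ (hγ i).neg).not fun ψ hψ => ?_).mono (hlc _ (hl i)) fun _ => id
      refine ⟨l i, hl i, hψ.1.neg.mono ?_, ?_⟩
      -- The arity bound of the lower level is compared with that of `lam` by way of `c`.
      · exact ((rho_le_clauseBound _ _).trans (hlc _ (hl i))).trans hcρ
      · rw [Formula.rank_neg]
        refine hψ.2.trans ?_
        rw [Formula.rank_neg]
        exact Formula.rank_le_rank_conj γ i
    refine ((hU.and hc.aleph0_le (.forall hc (hI.trans_le hκc) hI')).hasDNF
      (C' := RankedClass (rho κ lam) .sigma lam (Formula.conj I γ).rank)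
      (fun J δ hJ hδ => ?_) hpow).congr fun A B _ _ v₁ v₂ => realizeInSum_conj_iff Ξ
    choose k hk hδ using hδ
    exact ⟨.sigma_conj hlam J (hJ.trans_le hcρ) k hk δ fun j => (hδ j).1,
      Formula.rank_conj_le fun j => (hδ j).2⟩
  | @sigma_ex lam hlam n φ _ ih =>
    exact (((ih IH (snocLeft e) hK).ex hlam).or (aleph0_le_clauseBound _ _)
      ((ih IH (snocRight e) hK).ex_right hlam)).congr
        fun A B _ _ v₁ v₂ => realizeInSum_ex_iff Ξ
  | pi_disj => cases hK
  | pi_all => cases hK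

end Translation

/-! ### Feferman–Vaught decompositions -/

/-- The two structures determine the assignment uniquely, so the existential quantifier over
assignments in `IsModel` is harmless. -/
theorem ReductionSequence.isModel_iff (D : ReductionSequence.{p, q, w} L)
    (A B : CategoryTheory.Bundled.{u} L.Structure) (ζ : D.I ⊕ D.I → Bool)
    (h₁ : ∀ i, ζ (.inl i) = true ↔ Models A (D.Δ₁ i))
    (h₂ : ∀ i, ζ (.inr i) = true ↔ Models B (D.Δ₂ i)) : D.IsModel A B ↔ D.β.Eval ζ := by
  refine ⟨?_, fun h => ⟨ζ, h, fun i => ⟨h₁ i, h₂ i⟩⟩⟩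
  rintro ⟨ζ', h, hζ'⟩
  have : ζ' = ζ := by
    funext i
    rw [Bool.eq_iff_iff]
    rcases i with i | i
    · rw [(hζ' i).1, h₁]
    · rw [(hζ' i).2, h₂]
  rwa [← this]

/-- The reduction sequence `⋁ i, (X_{i,1} ∧ X_{i,2})`. -/
def ReductionSequence.ofDNF {J : Type w} (Ψ X : J → Formula.{p, q, w} L 0) :
    ReductionSequence.{p, q, w} L where
  I := J
  Δ₁ := Ψ
  Δ₂ := X
  β := .disj J fun j => .conj (ULift Bool) fun b => .var (bif b.down then .inl j else .inr j)

/-- The reduction sequence `⋀ i, (X_{i,1} ∨ X_{i,2})`. -/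
def ReductionSequence.ofCNF {J : Type w} (Ψ X : J → Formula.{p, q, w} L 0) :
    ReductionSequence.{p, q, w} L where
  I := J
  Δ₁ := Ψ
  Δ₂ := X
  β := .conj J fun j => .disj (ULift Bool) fun b => .var (bif b.down then .inl j else .inr j)

theorem ReductionSequence.isModel_ofDNF {J : Type w} (Ψ X : J → Formula.{p, q, w} L 0)
    (A B : CategoryTheory.Bundled.{u} L.Structure) :
    (ofDNF Ψ X).IsModel A B ↔ ∃ j, Models A (Ψ j) ∧ Models B (X j) := by
  classical
  rw [isModel_iff (ofDNF Ψ X) A B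
    (Sum.elim (fun j => decide (Models A (Ψ j))) fun j => decide (Models B (X j)))
    (fun j => decide_eq_true_iff (p := Models A (Ψ j)))
    fun j => decide_eq_true_iff (p := Models B (X j))]
  simp [ofDNF, PropFormula.Eval, and_comm]

theorem ReductionSequence.isModel_ofCNF {J : Type w} (Ψ X : J → Formula.{p, q, w} L 0)
    (A B : CategoryTheory.Bundled.{u} L.Structure) :
    (ofCNF Ψ X).IsModel A B ↔ ∀ j, Models A (Ψ j) ∨ Models B (X j) := by
  classical
  rw [isModel_iff (ofCNF Ψ X) A B
    (Sum.elim (fun j => decide (Models A (Ψ j))) fun j => decide (Models B (X j)))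
    (fun j => decide_eq_true_iff (p := Models A (Ψ j)))
    fun j => decide_eq_true_iff (p := Models B (X j))]
  simp [ofCNF, PropFormula.Eval, or_comm]

theorem models_neg (A : CategoryTheory.Bundled.{u} L.Structure) (φ : Formula.{p, q, w} L 0) :
    Models A φ.neg ↔ ¬ Models A φ :=
  letI := A.str
  Formula.realize_neg φ _

theorem models_iff_realizeInSum [L.IsRelational]
    {op : CategoryTheory.Bundled.{u} L.Structure → CategoryTheory.Bundled.{u} L.Structure →
      CategoryTheory.Bundled.{u} L.Structure}
    {Ξ : Interpretation.{p, q, w} (annotate L) L} {A B : CategoryTheory.Bundled.{u} L.Structure}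
    (hΞ : letI := (op A B).str
      letI := (Ξ.sumOp A B).str
      Nonempty ((op A B).α ≃[L] (Ξ.sumOp A B).α)) (φ : Formula.{p, q, w} L 0) :
    letI := A.str
    letI := B.str
    Models (op A B) φ ↔ RealizeInSum Ξ (Fin.elim0 : Fin 0 → Fin 0 ⊕ Fin 0) φ A.α B.α
      Fin.elim0 Fin.elim0 := by
  let := A.str
  let := B.str
  let := (op A B).str
  let := (Ξ.sumOp A B).str
  obtain ⟨f⟩ := hΞ
  have h := Formula.realize_equiv f φ Fin.elim0
  refine h.symm.trans ⟨fun h => ⟨_, fun i => i.elim0, h⟩, fun ⟨v, _, h⟩ => ?_⟩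
  have hv : v = fun i => f (Fin.elim0 (α := (op A B).α) i) := funext fun i => i.elim0
  rw [hv] at h
  exact h

/-- The decomposition of a sentence from `Σ̃_{κ,lam}`. -/
theorem exists_dnf_of_isQFSumLike [L.IsRelational]
    {op : CategoryTheory.Bundled.{u} L.Structure → CategoryTheory.Bundled.{u} L.Structure →
      CategoryTheory.Bundled.{u} L.Structure}
    (hop : IsQFSumLike.{p, q, w, u} op) {lam : Ordinal.{w}} {μ κ : Cardinal.{w}} (hκ : ℵ₀ ≤ κ)
    {φ : Formula.{p, q, w} L 0} (hφ : φ ∈ sentences L .sigma κ lam μ) :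
    ∃ (J : Type w) (Ψ X : J → Formula.{p, q, w} L 0),
      (∀ j, Ψ j ∈ sentences L .sigma (rho κ lam) lam μ) ∧
      (∀ j, X j ∈ sentences L .sigma (rho κ lam) lam μ) ∧
      ∀ A B : CategoryTheory.Bundled.{u} L.Structure,
        Models (op A B) φ ↔ ∃ j, Models A (Ψ j) ∧ Models B (X j) := by
  obtain ⟨Ξ, hΞ⟩ := hop
  obtain ⟨J, Ψ, X, -, hΨ, hX, h⟩ := hasDNF_realizeInSum.{p, q, w, u} Ξ hκ lam
    (Fin.elim0 : Fin 0 → Fin 0 ⊕ Fin 0) φ hφ.1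
  refine ⟨J, Ψ, X, fun j => ⟨(hΨ j).1, (hΨ j).2.trans hφ.2⟩,
    fun j => ⟨(hX j).1, (hX j).2.trans hφ.2⟩, fun A B => ?_⟩
  let := A.str
  let := B.str
  exact (models_iff_realizeInSum (hΞ A B) φ).trans (h A.α B.α _ _)

theorem exists_isFVDecomposition [L.IsRelational]
    {op : CategoryTheory.Bundled.{u} L.Structure → CategoryTheory.Bundled.{u} L.Structure →
      CategoryTheory.Bundled.{u} L.Structure}
    (hop : IsQFSumLike.{p, q, w, u} op) {lam : Ordinal.{w}} {μ κ : Cardinal.{w}} (hκ : ℵ₀ ≤ κ)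
    {K : Kind} {φ : Formula.{p, q, w} L 0} (hφ : φ ∈ sentences L K κ lam μ) :
    ∃ D : ReductionSequence.{p, q, w} L,
      D.Over (sentences L K (rho κ lam) lam μ) ∧ D.IsFVDecomposition op φ := by
  cases K with
  | sigma =>
    obtain ⟨J, Ψ, X, hΨ, hX, h⟩ := exists_dnf_of_isQFSumLike hop hκ hφ
    exact ⟨.ofDNF Ψ X, fun j => ⟨hΨ j, hX j⟩, fun A B =>
      (h A B).trans (ReductionSequence.isModel_ofDNF Ψ X A B).symm⟩
  | pi =>
    -- The negated sentence is `Σ̃` of the same rank; De Morgan turns its disjunctive decomposition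
    -- into a conjunctive one for `φ`.
    obtain ⟨J, Ψ, X, hΨ, hX, h⟩ := exists_dnf_of_isQFSumLike hop hκ (φ := φ.neg)
      ⟨hφ.1.neg, φ.rank_neg.trans_le hφ.2⟩
    refine ⟨.ofCNF (fun j => (Ψ j).neg) fun j => (X j).neg, fun j =>
      ⟨⟨(hΨ j).1.neg, (Ψ j).rank_neg.trans_le (hΨ j).2⟩,
        ⟨(hX j).1.neg, (X j).rank_neg.trans_le (hX j).2⟩⟩, fun A B => ?_⟩
    rw [ReductionSequence.isModel_ofCNF, ← not_iff_not, ← models_neg, h]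
    simp only [models_neg, not_forall, not_or, not_not]

end FVaught

theorem theorem2 {L : FirstOrder.Language.{p, q}} [L.IsRelational] [Finite (Σ k, L.Relations k)]
    (op : CategoryTheory.Bundled.{u} L.Structure → CategoryTheory.Bundled.{u} L.Structure → CategoryTheory.Bundled.{u} L.Structure)
    (hop : FVaught.IsQFSumLike.{p, q, w, u} op) (lam : Ordinal.{w}) (μ : Cardinal.{w}) :
    (∀ (K : FVaught.Kind) (κ : Cardinal.{w}), ℵ₀ ≤ κ → ∀ φ ∈ FVaught.sentences L K κ lam μ,
      ∃ D : FVaught.ReductionSequence.{p, q, w} L,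
        D.Over (FVaught.sentences L K (FVaught.rho κ lam) lam μ) ∧ D.IsFVDecomposition op φ) ∧
    (∀ (K : FVaught.Kind), ∀ φ ∈ FVaught.sentencesInf.{p, q, w} L K lam μ,
      ∃ D : FVaught.ReductionSequence.{p, q, w} L,
        D.Over (FVaught.sentencesInf L K lam μ) ∧ D.IsFVDecomposition op φ) := by
  refine ⟨fun K κ hκ φ hφ => FVaught.exists_isFVDecomposition hop hκ hφ, fun K φ hφ => ?_⟩
  obtain ⟨κ, hκ, hφ⟩ := hφ
  obtain ⟨D, hD, h⟩ := FVaught.exists_isFVDecomposition hop hκ hφ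
  exact ⟨D, fun i => ⟨⟨_, FVaught.aleph0_le_rho κ lam, (hD i).1⟩,
    ⟨_, FVaught.aleph0_le_rho κ lam, (hD i).2⟩⟩, h⟩
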